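/- **Theorem 5.2.** Let $n\ge 2$, let $t_0<T$ be real numbers, and let $a_0,a_1,\dots,a_n$ be real-valued continuous functions on $[t_0,+\infty)$. Consider the equation $$y'+\sum_{k=0}^{n}a_k(t)\,y^k=0. \qquad (1.1)$$ A solution $y$ of (1.1) on $[t_0,T]$ is called *closed* if $y(t_0)=y(T)$, and a closed solution $y$ is called *isolated* if there is $\varepsilon>0$ such that every closed solution $z$ of (1.1) on $[t_0,T]$ with $|z(t_0)-y(t_0)|<\varepsilon$ coincides with $y$ on $[t_0,T]$. For $\gamma\ge 0$ put $$I_\gamma(t)=\gamma\exp\Bigl\{-\int_{t_0}^{t}a_1(\tau)\,d\tau\Bigr\}+\int_{t_0}^{t}\exp\Bigl\{-\int_{\tau}^{t}a_1(s)\,ds\Bigr\}|a_0(\tau)|\,d\tau .$$ A *usable sequence* for $[t_0,+\infty)$ is a finite or infinite sequence $t_0<t_1<t_2<\cdots$ in $[t_0,+\infty]$ whose maximum is $+\infty$ if it is finite, and whose limit is $+\infty$ if it is infinite. Assume the following conditions. (C) $a_k(t)\ge 0$ for all $k=2,\dots,n$ and $t\ge t_0$. (D) There is a usable sequence $\{t_l\}$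 for $[t_0,+\infty)$ such that for every $l=1,2,\dots$ for which $t_{l+1}$ is a term of the sequence, and every $t\in[t_l,t_{l+1})$, $$\int_{t_l}^{t}\exp\Bigl\{\int_{t_l}^{\tau}\Bigl[a_1(s)-a_2(s)\int_{t_l}^{s}\exp\Bigl\{-\int_{\xi}^{s}a_1(\zeta)\,d\zeta\Bigr\}a_0(\xi)\,d\xi\Bigr]ds\Bigr\}a_0(\tau)\,d\tau\le 0 .$$ (E) For some $\gamma\ge 0$ and all $t\ge t_0$, $$\int_{t_0}^{t}\exp\Bigl\{\int_{t_0}^{\tau}\Bigl[\sum_{k=2}^{n}a_k(s)I_\gamma^{k-1}(s)+a_1(s)\Bigr]ds\Bigr\}a_0(\tau)\,d\tau\le 0 .$$ Suppose moreover that $\sum_{k=2}^{n}a_k\not\equiv 0$ on $[t_0,T]$ or $\int_{t_0}^{T}a_1(\tau)\,d\tau>0$. Then (1.1) has a nonnegative closed solution on $[t_0,T]$. If $\int_{t_0}^{T}a_1(\tau)\,d\tau>0$, then every nonnegative closed solution of (1.1) on $[t_0,T]$ is isolated. -/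

import Mathlib

namespace PolyODE

open Set Filter Topology

/-- `y` solves `y' + ∑_{k=0}^n a_k(t) y^k = 0` on `[t₀, T]`
(one-sided derivatives at the two end points). -/
def IsSolutionOn (n : ℕ) (a : ℕ → ℝ → ℝ) (t₀ T : ℝ) (y : ℝ → ℝ) : Prop :=
  ∀ t ∈ Icc t₀ T,
    HasDerivWithinAt y (-∑ k ∈ Finset.range (n + 1), a k t * y t ^ k) (Icc t₀ T) t

/-- A closed solution on `[t₀, T]`: a solution on `[t₀, T]` with `y(t₀) = y(T)`. -/
def IsClosedSolutionOn (n : ℕ) (a : ℕ → ℝ → ℝ) (t₀ T : ℝ) (y : ℝ → ℝ) : Prop :=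
  IsSolutionOn n a t₀ T y ∧ y t₀ = y T

/-- The closed solution `y` is isolated: no other closed solution on `[t₀, T]` (of any sign)
has its initial value within some `ε > 0` of `y(t₀)`. -/
def IsIsolatedClosedSolutionOn (n : ℕ) (a : ℕ → ℝ → ℝ) (t₀ T : ℝ) (y : ℝ → ℝ) : Prop :=
  IsClosedSolutionOn n a t₀ T y ∧
    ∃ ε > 0, ∀ z : ℝ → ℝ, IsClosedSolutionOn n a t₀ T z → |z t₀ - y t₀| < ε →
      EqOn z y (Icc t₀ T)

/-- `I_γ(t) = γ exp(-∫_{t₀}^t a₁) + ∫_{t₀}^t exp(-∫_τ^t a₁) |a₀(τ)| dτ`. -/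
noncomputable def I (a : ℕ → ℝ → ℝ) (t₀ γ t : ℝ) : ℝ :=
  γ * Real.exp (-∫ τ in t₀..t, a 1 τ) +
    ∫ τ in t₀..t, Real.exp (-∫ s in τ..t, a 1 s) * |a 0 τ|

/-- A usable sequence for `[t₀, τ₀)`, `τ₀ ≤ +∞`: a finite or infinite sequence
`t₀ = s₀ < s₁ < …` in `[t₀, τ₀]`, whose maximum is `τ₀` if it is finite, and which
converges to `τ₀` if it is infinite. The number of terms is `N : ℕ∞`, so that the terms are
the `s k` with `k < N`; the other values of `s` are irrelevant. -/
structure IsUsableSequence (t₀ : ℝ) (τ₀ : EReal) (N : ℕ∞) (s : ℕ → EReal) : Prop where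
  pos : 0 < N
  zero : s 0 = (t₀ : EReal)
  lt_succ : ∀ k : ℕ, ((k + 1 : ℕ) : ℕ∞) < N → s k < s (k + 1)
  le_right : ∀ k : ℕ, (k : ℕ∞) < N → s k ≤ τ₀
  max_eq : N ≠ ⊤ → ∃ k : ℕ, (k : ℕ∞) < N ∧ s k = τ₀
  tendsto : N = ⊤ → Tendsto s atTop (𝓝 τ₀)

/-- The integral condition of Riccati type started at the point `r`, at time `t`:
`∫_r^t exp{∫_r^τ [a₁(σ) - a₂(σ) ∫_r^σ exp(-∫_ξ^σ a₁) a₀(ξ) dξ] dσ} a₀(τ) dτ ≤ 0`. -/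
def RiccatiCondition (a : ℕ → ℝ → ℝ) (r t : ℝ) : Prop :=
  ∫ τ in r..t,
    Real.exp (∫ σ in r..τ,
      (a 1 σ - a 2 σ * ∫ ξ in r..σ, Real.exp (-∫ ζ in ξ..σ, a 1 ζ) * a 0 ξ)) * a 0 τ ≤ 0

/-- The integral condition with weight built from `I_γ`, at time `t`:
`∫_{t₀}^t exp{∫_{t₀}^τ [∑_{k=2}^n a_k(s) I_γ(s)^{k-1} + a₁(s)] ds} a₀(τ) dτ ≤ 0`. -/
def WeightedCondition (n : ℕ) (a : ℕ → ℝ → ℝ) (t₀ γ t : ℝ) : Prop :=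
  ∫ τ in t₀..t,
    Real.exp (∫ s in t₀..τ,
      ((∑ k ∈ Finset.Icc 2 n, a k s * I a t₀ γ s ^ (k - 1)) + a 1 s)) * a 0 τ ≤ 0

end PolyODE

namespace PolyODE

open Set Filter Topology

/-! A closed solution is a fixed point of the map taking an initial value to the value at `T`.
Variation of constants turns condition (E) into the nonnegativity of the solution `f` of a linear
equation, whose coefficient is the nonlinear one evaluated at `I`. As `0 ≤ f ≤ I` and the higher
coefficients are nonnegative, `f` is a subsolution of the full equation
(`exists_nonneg_subsolution`). Solutions starting at `x ≥ 0` lie above `f`, and the nonlinear terms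
only push them down, so they exist up to `T` and are ordered by `x` (`exists_nonneg_flow`). Large
initial values do not grow over the interval (`exists_return_le`), so some `[0, M]` is mapped
monotonically into itself.

For isolation, the difference of two solutions satisfies a linear equation whose coefficient is
minus a divided difference. Near a nonnegative solution this divided difference is almost bounded
below by `b 1` (`le_dividedDiff`). If `b 1` has positive integral, distances shrink strictly over
the interval, which two distinct closed solutions cannot do. -/

/-! ### Differential inequalities and scalar Lipschitz equations. -/

/-- A function with `v' ≤ c v` multiplied by the integrating factor `exp (-∫ c)` is antitone. -/
lemma antitoneOn_mul_exp {t₀ T : ℝ} {v v' c : ℝ → ℝ} (hc : Continuous c)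
    (hv : ∀ t ∈ Icc t₀ T, HasDerivWithinAt v (v' t) (Icc t₀ T) t)
    (h : ∀ t ∈ Icc t₀ T, v' t ≤ c t * v t) :
    AntitoneOn (fun t => v t * Real.exp (-∫ s in t₀..t, c s)) (Icc t₀ T) := by
  have hA : ∀ t, HasDerivAt (fun t => ∫ s in t₀..t, c s) (c t) t := fun t =>
    intervalIntegral.integral_hasDerivAt_right (hc.intervalIntegrable _ _)
      (hc.stronglyMeasurableAtFilter _ _) hc.continuousAt
  have hd : ∀ t ∈ Icc t₀ T, HasDerivWithinAt (fun t => v t * Real.exp (-∫ s in t₀..t, c s))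
      (v' t * Real.exp (-∫ s in t₀..t, c s) +
        v t * (Real.exp (-∫ s in t₀..t, c s) * -c t)) (Icc t₀ T) t := fun t ht =>
    (hv t ht).mul ((hA t).neg.exp.hasDerivWithinAt)
  refine antitoneOn_of_hasDerivWithinAt_nonpos (convex_Icc _ _)
    (fun t ht => (hd t ht).continuousWithinAt)
    (fun t ht => (hd t (interior_subset ht)).mono interior_subset) fun t ht => ?_
  have := h t (interior_subset ht)
  have e := Real.exp_pos (-∫ s in t₀..t, c s)
  nlinarith [mul_le_mul_of_nonneg_right this e.le]

/-- Gronwall's inequality for a linear differential inequality with variable coefficient. -/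
lemma le_mul_exp_of_deriv_le {t₀ T : ℝ} (hT : t₀ ≤ T) {v v' c : ℝ → ℝ} (hc : Continuous c)
    (hv : ∀ t ∈ Icc t₀ T, HasDerivWithinAt v (v' t) (Icc t₀ T) t)
    (h : ∀ t ∈ Icc t₀ T, v' t ≤ c t * v t) {t : ℝ} (ht : t ∈ Icc t₀ T) :
    v t ≤ v t₀ * Real.exp (∫ s in t₀..t, c s) := by
  have h1 := antitoneOn_mul_exp hc hv h (left_mem_Icc.2 hT) ht ht.1
  simp only [intervalIntegral.integral_same, neg_zero, Real.exp_zero, mul_one] at h1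
  have e := Real.exp_pos (∫ s in t₀..t, c s)
  have h2 := mul_le_mul_of_nonneg_right h1 e.le
  rwa [mul_assoc, ← Real.exp_add, neg_add_cancel, Real.exp_zero, mul_one] at h2

lemma hasDerivWithinAt_Ici_of_Icc {f : ℝ → ℝ} {f' a b t : ℝ} (ht : t ∈ Ico a b)
    (h : HasDerivWithinAt f f' (Icc a b) t) : HasDerivWithinAt f f' (Ici t) t :=
  h.mono_of_mem_nhdsWithin (mem_of_superset (Icc_mem_nhdsGE ht.2) (Icc_subset_Icc_left ht.1))

/-- Comparison of a subsolution and a supersolution of a Lipschitz scalar equation. -/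
lemma le_of_subsolution_supersolution {t₀ T C : ℝ} {G : ℝ → ℝ → ℝ}
    {f f' g g' : ℝ → ℝ}
    (hG : ∀ t ∈ Icc t₀ T, ∀ u v, |G t u - G t v| ≤ C * |u - v|)
    (hf : ∀ t ∈ Icc t₀ T, HasDerivWithinAt f (f' t) (Icc t₀ T) t)
    (hg : ∀ t ∈ Icc t₀ T, HasDerivWithinAt g (g' t) (Icc t₀ T) t)
    (hf' : ∀ t ∈ Icc t₀ T, f' t ≤ G t (f t)) (hg' : ∀ t ∈ Icc t₀ T, G t (g t) ≤ g' t)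
    (h0 : f t₀ ≤ g t₀) {t : ℝ} (ht : t ∈ Icc t₀ T) : f t ≤ g t := by
  -- The rate `C + 1` exceeds the Lipschitz constant, so the perturbed `g` grows strictly faster
  -- than `f` at any contact point.
  have key : ∀ ε > 0, f t ≤ g t + ε * Real.exp ((C + 1) * (t - t₀)) := by
    intro ε hε
    have hE : ∀ x, HasDerivAt (fun x => ε * Real.exp ((C + 1) * (x - t₀)))
        (ε * (Real.exp ((C + 1) * (x - t₀)) * ((C + 1) * 1))) x := fun x =>
      ((((hasDerivAt_id x).sub_const t₀).const_mul (C + 1)).exp).const_mul ε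
    refine image_le_of_deriv_right_lt_deriv_boundary' (f := f) (f' := f')
      (B := fun x => g x + ε * Real.exp ((C + 1) * (x - t₀)))
      (B' := fun x => g' x + ε * (Real.exp ((C + 1) * (x - t₀)) * ((C + 1) * 1)))
      (fun x hx => (hf x hx).continuousWithinAt)
      (fun x hx => hasDerivWithinAt_Ici_of_Icc hx (hf x (Ico_subset_Icc_self hx)))
      ?_ (fun x hx => ((hg x hx).add (hE x).hasDerivWithinAt).continuousWithinAt)
      (fun x hx => (hasDerivWithinAt_Ici_of_Icc hx (hg x (Ico_subset_Icc_self hx))).add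
        (hE x).hasDerivWithinAt) ?_ ht
    · simp only [sub_self, mul_zero, Real.exp_zero]
      linarith
    · intro x hx hfx
      have hx' := Ico_subset_Icc_self hx
      have h1 := hf' x hx'
      have h2 := hg' x hx'
      have h3 := (abs_le.1 (hG x hx' (f x) (g x))).2
      have hp : 0 < ε * Real.exp ((C + 1) * (x - t₀)) := by positivity
      have h4 : f x - g x = ε * Real.exp ((C + 1) * (x - t₀)) := by
        rw [hfx]; ring
      rw [h4, abs_of_pos hp] at h3
      nlinarith
  refine le_of_forall_pos_le_add fun δ hδ => ?_
  have e := Real.exp_pos ((C + 1) * (t - t₀))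
  have := key (δ / Real.exp ((C + 1) * (t - t₀))) (by positivity)
  rwa [div_mul_cancel₀ _ e.ne'] at this

/-- A bounded Lipschitz scalar equation has a solution on `[t₀, T]` for every initial value. -/
lemma exists_solution_of_lipschitz {t₀ T C B : ℝ} (hT : t₀ ≤ T) {G : ℝ → ℝ → ℝ}
    (hC : 0 ≤ C) (hB : 0 ≤ B)
    (hG : ∀ t ∈ Icc t₀ T, ∀ u v, |G t u - G t v| ≤ C * |u - v|)
    (hcont : ∀ u, Continuous fun t => G t u)
    (hbd : ∀ t ∈ Icc t₀ T, ∀ u, |G t u| ≤ B) (x : ℝ) :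
    ∃ y : ℝ → ℝ, y t₀ = x ∧ ∀ t ∈ Icc t₀ T, HasDerivWithinAt y (G t (y t)) (Icc t₀ T) t := by
  have hPL : IsPicardLindelof G (⟨t₀, left_mem_Icc.2 hT⟩ : Icc t₀ T) x
      ⟨B * (T - t₀), mul_nonneg hB (sub_nonneg.2 hT)⟩ 0 ⟨B, hB⟩ ⟨C, hC⟩ := by
    refine ⟨fun t ht => ?_, fun u _ => (hcont u).continuousOn, fun t ht u _ => hbd t ht u, ?_⟩
    · refine LipschitzOnWith.of_dist_le_mul fun u _ v _ => ?_
      rw [Real.dist_eq, Real.dist_eq]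
      exact hG t ht u v
    · change B * max (T - t₀) (t₀ - t₀) ≤ B * (T - t₀) - 0
      rw [sub_self, max_eq_left (sub_nonneg.2 hT), sub_zero]
  exact hPL.exists_eq_forall_mem_Icc_hasDerivWithinAt₀

/-! ### Algebra of the right-hand side. -/

/-- The polynomial `∑_{k=0}^n b_k(t) y^k`. -/
noncomputable def poly (n : ℕ) (b : ℕ → ℝ → ℝ) (t y : ℝ) : ℝ :=
  ∑ k ∈ Finset.range (n + 1), b k t * y ^ k

/-- The divided difference of `poly n b t` at the points `u` and `v`. -/
noncomputable def dividedDiff (n : ℕ) (b : ℕ → ℝ → ℝ) (t u v : ℝ) : ℝ :=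
  ∑ k ∈ Finset.range (n + 1), b k t * ∑ i ∈ Finset.range k, u ^ i * v ^ (k - 1 - i)

/-- A bound of the divided difference on `[-R, R]` when the coefficients are bounded by `B`. -/
noncomputable def diffBound (n : ℕ) (B R : ℝ) : ℝ :=
  ∑ k ∈ Finset.range (n + 1), B * ∑ i ∈ Finset.range k, R ^ i * R ^ (k - 1 - i)

/-- The nonlinear part `∑_{k=2}^n b_k(t) y^{k-1}` of the coefficient of `y` in `poly n b t y`. -/
noncomputable def nonlinearCoeff (n : ℕ) (b : ℕ → ℝ → ℝ) (t y : ℝ) : ℝ :=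
  ∑ k ∈ Finset.Icc 2 n, b k t * y ^ (k - 1)

lemma sum_range_eq_add_sum_Icc {n : ℕ} (hn : 2 ≤ n) (f : ℕ → ℝ) :
    ∑ k ∈ Finset.range (n + 1), f k = f 0 + f 1 + ∑ k ∈ Finset.Icc 2 n, f k := by
  have : Finset.range (n + 1) = insert 0 (insert 1 (Finset.Icc 2 n)) := by
    ext k; simp; omega
  rw [this, Finset.sum_insert (by simp), Finset.sum_insert (by simp), add_assoc]

lemma poly_eq {n : ℕ} (hn : 2 ≤ n) (b : ℕ → ℝ → ℝ) (t y : ℝ) :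
    poly n b t y = b 0 t + (b 1 t + nonlinearCoeff n b t y) * y := by
  rw [poly, sum_range_eq_add_sum_Icc hn, nonlinearCoeff, add_mul, Finset.sum_mul]
  simp only [pow_zero, mul_one, pow_one, add_assoc]
  congr 2
  refine Finset.sum_congr rfl fun k hk => ?_
  have := (Finset.mem_Icc.1 hk).1
  rw [mul_assoc, ← pow_succ, Nat.sub_add_cancel (by omega)]

lemma poly_sub_poly (n : ℕ) (b : ℕ → ℝ → ℝ) (t u v : ℝ) :
    poly n b t u - poly n b t v = dividedDiff n b t u v * (u - v) := by
  simp only [poly, dividedDiff, Finset.sum_mul, ← Finset.sum_sub_distrib]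
  refine Finset.sum_congr rfl fun k _ => ?_
  rw [mul_assoc, geom_sum₂_mul, mul_sub]

lemma diffBound_nonneg (n : ℕ) {B R : ℝ} (hB : 0 ≤ B) (hR : 0 ≤ R) : 0 ≤ diffBound n B R :=
  Finset.sum_nonneg fun _ _ => mul_nonneg hB (Finset.sum_nonneg fun _ _ => by positivity)

lemma abs_dividedDiff_le {n : ℕ} {b : ℕ → ℝ → ℝ} {t u v B R : ℝ}
    (hb : ∀ k ≤ n, |b k t| ≤ B) (hu : |u| ≤ R) (hv : |v| ≤ R) :
    |dividedDiff n b t u v| ≤ diffBound n B R := by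
  have hR : 0 ≤ R := (abs_nonneg _).trans hu
  refine (Finset.abs_sum_le_sum_abs _ _).trans (Finset.sum_le_sum fun k hk => ?_)
  have hk : k ≤ n := by simpa [Nat.lt_succ_iff] using hk
  rw [abs_mul]
  refine mul_le_mul (hb k hk) ((Finset.abs_sum_le_sum_abs _ _).trans
    (Finset.sum_le_sum fun i _ => ?_)) (abs_nonneg _) ((abs_nonneg _).trans (hb k hk))
  rw [abs_mul, abs_pow, abs_pow]
  gcongr

/-- Only a negative `u` with a positive exponent matters: one factor is then at most `δ` in absolute
value, and `1 ≤ R` absorbs the lost power. -/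
lemma neg_mul_le_pow_mul_pow {u v δ R : ℝ} (hR : 1 ≤ R) (hδ : 0 ≤ δ) (hu : |u| ≤ R) (hv : 0 ≤ v)
    (hvR : v ≤ R) (hδu : -δ ≤ u) (i j : ℕ) : -(δ * (R ^ i * R ^ j)) ≤ u ^ i * v ^ j := by
  have hR0 : 0 ≤ R := by linarith
  rcases i with _ | i
  · have : 0 ≤ v ^ j := by positivity
    have : 0 ≤ δ * R ^ j := by positivity
    simp only [pow_zero, one_mul]; linarith
  · rcases le_or_gt 0 u with h | h
    · have : 0 ≤ u ^ (i + 1) * v ^ j := by positivity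
      have : 0 ≤ δ * (R ^ (i + 1) * R ^ j) := by positivity
      linarith
    · refine (abs_le.1 ?_).1
      rw [abs_mul, abs_pow, abs_pow, pow_succ', mul_assoc]
      have h1 : |u| ≤ δ := by rw [abs_of_neg h]; linarith
      have h2 : |u| ^ i ≤ R ^ (i + 1) :=
        (pow_le_pow_left₀ (abs_nonneg _) hu i).trans (pow_le_pow_right₀ hR (Nat.le_succ i))
      have h3 : |v| ^ j ≤ R ^ j := by rw [abs_of_nonneg hv]; gcongr
      gcongr

/-- For nonnegative `u` and `v` the terms with `k ≥ 2` are nonnegative, leaving `b 1 t`. Letting `u`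
drop to `-δ` costs a multiple of `δ`; this admits nearby solutions that change sign. -/
lemma le_dividedDiff {n : ℕ} (hn : 2 ≤ n) {b : ℕ → ℝ → ℝ} {t u v B R δ : ℝ}
    (hb : ∀ k ≤ n, |b k t| ≤ B) (hpos : ∀ k, 2 ≤ k → 0 ≤ b k t) (hR : 1 ≤ R) (hδ : 0 ≤ δ)
    (hu : |u| ≤ R) (hv : 0 ≤ v) (hvR : v ≤ R) (hδu : -δ ≤ u) :
    b 1 t - δ * diffBound n B R ≤ dividedDiff n b t u v := by
  have hB : 0 ≤ B := (abs_nonneg _).trans (hb 0 (Nat.zero_le _))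
  rw [dividedDiff, diffBound, sum_range_eq_add_sum_Icc hn, sum_range_eq_add_sum_Icc hn]
  simp only [Finset.range_zero, Finset.sum_empty, mul_zero, Finset.range_one, Finset.sum_singleton,
    zero_add, Nat.sub_self, pow_zero, mul_one]
  have : -(δ * ∑ k ∈ Finset.Icc 2 n, B * ∑ i ∈ Finset.range k, R ^ i * R ^ (k - 1 - i)) ≤
      ∑ k ∈ Finset.Icc 2 n, b k t * ∑ i ∈ Finset.range k, u ^ i * v ^ (k - 1 - i) := by
    rw [Finset.mul_sum, ← Finset.sum_neg_distrib]
    refine Finset.sum_le_sum fun k hk => ?_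
    obtain ⟨h2, hkn⟩ := Finset.mem_Icc.1 hk
    have h3 : -(δ * ∑ i ∈ Finset.range k, R ^ i * R ^ (k - 1 - i)) ≤
        ∑ i ∈ Finset.range k, u ^ i * v ^ (k - 1 - i) := by
      rw [Finset.mul_sum, ← Finset.sum_neg_distrib]
      exact Finset.sum_le_sum fun i _ => neg_mul_le_pow_mul_pow hR hδ hu hv hvR hδu _ _
    have h4 : 0 ≤ δ * ∑ i ∈ Finset.range k, R ^ i * R ^ (k - 1 - i) :=
      mul_nonneg hδ (Finset.sum_nonneg fun _ _ => by positivity)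
    have h5 := hpos k h2
    have h6 := (abs_le.1 (hb k hkn)).2
    nlinarith [mul_le_mul_of_nonneg_left h3 h5, mul_le_mul_of_nonneg_right h6 h4]
  -- The slack `δ * B` is the `k = 1` term of `δ * diffBound n B R`.
  nlinarith [mul_nonneg hδ hB]

lemma abs_poly_le {n : ℕ} {b : ℕ → ℝ → ℝ} {t u B R : ℝ}
    (hb : ∀ k ≤ n, |b k t| ≤ B) (hu : |u| ≤ R) :
    |poly n b t u| ≤ ∑ k ∈ Finset.range (n + 1), B * R ^ k := by
  refine (Finset.abs_sum_le_sum_abs _ _).trans (Finset.sum_le_sum fun k hk => ?_)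
  have hk : k ≤ n := by simpa [Nat.lt_succ_iff] using hk
  have hR : 0 ≤ R := (abs_nonneg _).trans hu
  have := (abs_nonneg _).trans (hb k hk)
  rw [abs_mul, abs_pow]
  gcongr
  exact hb k hk

lemma nonlinearCoeff_mono {n : ℕ} {b : ℕ → ℝ → ℝ} {t u v : ℝ} (hpos : ∀ k, 2 ≤ k → 0 ≤ b k t)
    (hu : 0 ≤ u) (huv : u ≤ v) : nonlinearCoeff n b t u ≤ nonlinearCoeff n b t v :=
  Finset.sum_le_sum fun k hk => by
    have := hpos k (Finset.mem_Icc.1 hk).1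
    gcongr

lemma nonlinearCoeff_nonneg {n : ℕ} {b : ℕ → ℝ → ℝ} {t u : ℝ} (hpos : ∀ k, 2 ≤ k → 0 ≤ b k t)
    (hu : 0 ≤ u) : 0 ≤ nonlinearCoeff n b t u :=
  Finset.sum_nonneg fun k hk => mul_nonneg (hpos k (Finset.mem_Icc.1 hk).1) (by positivity)

lemma mul_sum_le_nonlinearCoeff {n : ℕ} {b : ℕ → ℝ → ℝ} {t u m : ℝ}
    (hpos : ∀ k, 2 ≤ k → 0 ≤ b k t) (hm : 1 ≤ m) (hu : m ≤ u) :
    m * ∑ k ∈ Finset.Icc 2 n, b k t ≤ nonlinearCoeff n b t u := by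
  rw [Finset.mul_sum]
  refine Finset.sum_le_sum fun k hk => ?_
  have h2 := (Finset.mem_Icc.1 hk).1
  have h3 : m ≤ u ^ (k - 1) := hu.trans (le_self_pow₀ (hm.trans hu) (by omega))
  nlinarith [hpos k h2, mul_le_mul_of_nonneg_left h3 (hpos k h2)]


/-! ### Nonnegative subsolution and flow. -/

/-- Continuous coefficients bounded by `B`, with nonnegative `b k` for `2 ≤ k`. -/
structure IsAdmissible (b : ℕ → ℝ → ℝ) (B : ℝ) : Prop where
  cont : ∀ k, Continuous (b k)
  nonneg : ∀ k, 2 ≤ k → ∀ t, 0 ≤ b k t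
  bound : ∀ k t, |b k t| ≤ B

lemma hasDerivAt_integral {f : ℝ → ℝ} (hf : Continuous f) (t₀ t : ℝ) :
    HasDerivAt (fun t => ∫ s in t₀..t, f s) (f t) t :=
  intervalIntegral.integral_hasDerivAt_right (hf.intervalIntegrable _ _)
    (hf.stronglyMeasurableAtFilter _ _) hf.continuousAt

lemma continuous_integral {f : ℝ → ℝ} (hf : Continuous f) (t₀ : ℝ) :
    Continuous fun t => ∫ s in t₀..t, f s :=
  continuous_iff_continuousAt.2 fun t => (hasDerivAt_integral hf t₀ t).continuousAt

/-- Moves the dependence on `t` out of the integrand, so that the fundamental theorem of calculus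
applies. -/
lemma I_eq {b : ℕ → ℝ → ℝ} (h1 : Continuous (b 1)) (t₀ γ t : ℝ) :
    I b t₀ γ t = Real.exp (-∫ τ in t₀..t, b 1 τ) *
      (γ + ∫ τ in t₀..t, Real.exp (∫ s in t₀..τ, b 1 s) * |b 0 τ|) := by
  rw [I, mul_add, mul_comm γ, ← intervalIntegral.integral_const_mul]
  congr 1
  refine intervalIntegral.integral_congr fun τ _ => ?_
  rw [← mul_assoc, ← Real.exp_add, ← intervalIntegral.integral_add_adjacent_intervals
    (h1.intervalIntegrable t₀ τ) (h1.intervalIntegrable τ t)]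
  congr 2
  ring

lemma hasDerivAt_I {b : ℕ → ℝ → ℝ} (h0 : Continuous (b 0)) (h1 : Continuous (b 1))
    (t₀ γ t : ℝ) : HasDerivAt (I b t₀ γ) (-b 1 t * I b t₀ γ t + |b 0 t|) t := by
  have hc : Continuous fun τ => Real.exp (∫ s in t₀..τ, b 1 s) * |b 0 τ| :=
    (continuous_integral h1 t₀).rexp.mul h0.abs
  rw [funext (I_eq h1 t₀ γ)]
  refine (((hasDerivAt_integral h1 t₀ t).neg.exp).mul
    ((hasDerivAt_integral hc t₀ t).const_add γ)).congr_deriv ?_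
  have he : Real.exp (-∫ s in t₀..t, b 1 s) * Real.exp (∫ s in t₀..t, b 1 s) = 1 := by
    rw [← Real.exp_add, neg_add_cancel, Real.exp_zero]
  simp only [Pi.neg_apply]
  linear_combination |b 0 t| * he

lemma I_nonneg {b : ℕ → ℝ → ℝ} {t₀ γ t : ℝ} (hγ : 0 ≤ γ) (ht : t₀ ≤ t) : 0 ≤ I b t₀ γ t :=
  add_nonneg (by positivity) (intervalIntegral.integral_nonneg ht fun _ _ => by positivity)

/-- The weighted condition yields a nonnegative subsolution that starts at `0`. -/
lemma exists_nonneg_subsolution {n : ℕ} (hn : 2 ≤ n) {b : ℕ → ℝ → ℝ} {B t₀ T γ : ℝ}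
    (hT : t₀ ≤ T) (hb : IsAdmissible b B) (hγ : 0 ≤ γ)
    (hE : ∀ t ∈ Icc t₀ T, WeightedCondition n b t₀ γ t) :
    ∃ f f' : ℝ → ℝ, f t₀ = 0 ∧ ∀ t ∈ Icc t₀ T,
      HasDerivWithinAt f (f' t) (Icc t₀ T) t ∧ 0 ≤ f t ∧ f' t ≤ -poly n b t (f t) := by
  have hI := hasDerivAt_I (hb.cont 0) (hb.cont 1) t₀ γ
  have hIc : Continuous (I b t₀ γ) := continuous_iff_continuousAt.2 fun t => (hI t).continuousAt
  set Q : ℝ → ℝ := fun s => (∑ k ∈ Finset.Icc 2 n, b k s * I b t₀ γ s ^ (k - 1)) + b 1 s with hQ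
  have hQc : Continuous Q :=
    (continuous_finsetSum _ fun k _ => (hb.cont k).mul (hIc.pow _)).add (hb.cont 1)
  have hQI : ∀ t, Q t = b 1 t + nonlinearCoeff n b t (I b t₀ γ t) := fun t => add_comm _ _
  have hFc : Continuous fun τ => Real.exp (∫ s in t₀..τ, Q s) * b 0 τ :=
    (continuous_integral hQc t₀).rexp.mul (hb.cont 0)
  set f : ℝ → ℝ := fun t => Real.exp (-∫ s in t₀..t, Q s) *
    -∫ τ in t₀..t, Real.exp (∫ s in t₀..τ, Q s) * b 0 τ with hf
  have hd : ∀ t, HasDerivAt f (-Q t * f t - b 0 t) t := fun t => by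
    refine (((hasDerivAt_integral hQc t₀ t).neg.exp).mul
      ((hasDerivAt_integral hFc t₀ t).neg)).congr_deriv ?_
    have he : Real.exp (-∫ s in t₀..t, Q s) * Real.exp (∫ s in t₀..t, Q s) = 1 := by
      rw [← Real.exp_add, neg_add_cancel, Real.exp_zero]
    simp only [hf, Pi.neg_apply]
    linear_combination -b 0 t * he
  have hf0 : ∀ t ∈ Icc t₀ T, 0 ≤ f t := fun t ht =>
    mul_nonneg (Real.exp_pos _).le (neg_nonneg.2 (hE t ht))
  have hQ1 : ∀ t ∈ Icc t₀ T, b 1 t ≤ Q t := fun t ht => by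
    rw [hQI]
    linarith [nonlinearCoeff_nonneg (n := n) (fun k hk => hb.nonneg k hk t)
      (I_nonneg (b := b) hγ ht.1)]
  -- From `f ≥ 0`, `Q ≥ b 1` and `-b 0 ≤ |b 0|` the difference satisfies `(f - I)' ≤ -b 1 * (f -
  -- I)`, and it starts at `-γ`.
  have hfI : ∀ t ∈ Icc t₀ T, f t ≤ I b t₀ γ t := fun t ht => by
    have h1 := le_mul_exp_of_deriv_le (v := fun t => f t - I b t₀ γ t) hT (hb.cont 1).neg
      (fun t _ => ((hd t).sub (hI t)).hasDerivWithinAt) (fun t ht => by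
        change _ ≤ -b 1 t * (f t - I b t₀ γ t)
        nlinarith [hf0 t ht, hQ1 t ht, neg_abs_le (b 0 t)]) ht
    have h2 : f t₀ - I b t₀ γ t₀ ≤ 0 := by simp [hf, I, hγ]
    linarith [mul_nonpos_of_nonpos_of_nonneg h2 (Real.exp_pos (∫ s in t₀..t, (-b 1) s)).le]
  refine ⟨f, fun t => -Q t * f t - b 0 t, by simp [hf], fun t ht =>
    ⟨(hd t).hasDerivWithinAt, hf0 t ht, ?_⟩⟩
  change -Q t * f t - b 0 t ≤ _
  rw [poly_eq hn, hQI]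
  nlinarith [hf0 t ht,
    nonlinearCoeff_mono (n := n) (fun k hk => hb.nonneg k hk t) (hf0 t ht) (hfI t ht)]

/-- If there is a nonnegative subsolution starting at `0`, then the solutions with initial value in
`[0, M]` exist up to time `T`, stay nonnegative and depend monotonically on the initial value. -/
lemma exists_nonneg_flow {n : ℕ} (hn : 2 ≤ n) {b : ℕ → ℝ → ℝ} {B t₀ T M : ℝ}
    (hT : t₀ ≤ T) (hb : IsAdmissible b B) (hM : 0 ≤ M) {f f' : ℝ → ℝ} (hf0 : f t₀ = 0)
    (hf : ∀ t ∈ Icc t₀ T,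
      HasDerivWithinAt f (f' t) (Icc t₀ T) t ∧ 0 ≤ f t ∧ f' t ≤ -poly n b t (f t)) :
    ∃ Y : ℝ → ℝ → ℝ, (∀ x ∈ Icc 0 M, Y x t₀ = x ∧ IsSolutionOn n b t₀ T (Y x) ∧
      ∀ t ∈ Icc t₀ T, 0 ≤ Y x t) ∧
      ∀ x ∈ Icc 0 M, ∀ x' ∈ Icc 0 M, x ≤ x' → Y x T ≤ Y x' T := by
  have hB : 0 ≤ B := (abs_nonneg _).trans (hb.bound 0 0)
  -- A strict upper barrier: since `U ≥ 1`, the slope at contact is at most `B + B * U < (2 * B + 1)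
  -- * U`.
  set U : ℝ → ℝ := fun t => (M + 1) * Real.exp ((2 * B + 1) * (t - t₀)) with hU
  have hU1 : ∀ t ∈ Icc t₀ T, 1 ≤ U t := fun t ht => by
    have : 1 ≤ Real.exp ((2 * B + 1) * (t - t₀)) :=
      Real.one_le_exp (mul_nonneg (by linarith) (sub_nonneg.2 ht.1))
    simp only [hU]; nlinarith
  have hUT : ∀ t ∈ Icc t₀ T, U t ≤ U T := fun t ht => by
    simp only [hU]
    have := ht.2
    gcongr
  have hUd : ∀ t, HasDerivAt U ((2 * B + 1) * U t) t := fun t => by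
    refine (((((hasDerivAt_id t).sub_const t₀).const_mul (2 * B + 1)).exp).const_mul
      (M + 1)).congr_deriv ?_
    simp only [hU, id]; ring
  set R := U T with hR
  have hR1 : 1 ≤ R := hU1 T (right_mem_Icc.2 hT)
  -- Clamping to `[0, R]` makes the equation globally Lipschitz and bounded; the solutions used
  -- below never leave `[0, R]`, so they solve the original equation.
  set cl : ℝ → ℝ := fun y => max 0 (min y R) with hcl
  have hclR : ∀ y, |cl y| ≤ R := fun y => by
    rw [abs_of_nonneg (le_max_left _ _)]
    exact max_le (by linarith) (min_le_right _ _)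
  have hcl_eq : ∀ y, 0 ≤ y → y ≤ R → cl y = y := fun y h0 h1 => by
    simp only [hcl]; rw [min_eq_left h1, max_eq_right h0]
  have hcl_lip : ∀ u v, |cl u - cl v| ≤ |u - v| := fun u v => by
    simp only [hcl]
    rw [max_comm 0, max_comm 0]
    refine (abs_max_sub_max_le_abs _ _ 0).trans ((abs_min_sub_min_le_max u R v R).trans ?_)
    simp
  set G : ℝ → ℝ → ℝ := fun t y => -poly n b t (cl y) with hG
  have hGlip : ∀ t ∈ Icc t₀ T, ∀ u v, |G t u - G t v| ≤ diffBound n B R * |u - v| :=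
    fun t _ u v => by
      have h1 : |G t u - G t v| = |dividedDiff n b t (cl u) (cl v)| * |cl u - cl v| := by
        rw [← abs_mul, ← poly_sub_poly, ← abs_neg]; simp only [hG]; ring_nf
      rw [h1]
      exact mul_le_mul (abs_dividedDiff_le (fun k _ => hb.bound k t) (hclR u) (hclR v))
        (hcl_lip u v) (abs_nonneg _) (diffBound_nonneg n hB (by linarith))
  have hex : ∀ x : ℝ, ∃ y : ℝ → ℝ, y t₀ = x ∧
      ∀ t ∈ Icc t₀ T, HasDerivWithinAt y (G t (y t)) (Icc t₀ T) t :=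
    exists_solution_of_lipschitz (B := ∑ k ∈ Finset.range (n + 1), B * R ^ k) hT
      (diffBound_nonneg n hB (by linarith)) (Finset.sum_nonneg fun _ _ => by positivity) hGlip
      (fun u => (continuous_finsetSum _ fun k _ => (hb.cont k).mul continuous_const).neg)
      (fun t _ u => by
        simp only [hG, abs_neg]
        exact abs_poly_le (fun k _ => hb.bound k t) (hclR u))
  choose Y hY0 hY using hex
  have hup : ∀ x ∈ Icc 0 M, ∀ t ∈ Icc t₀ T, Y x t ≤ U t := fun x hx t ht => by
    refine image_le_of_deriv_right_lt_deriv_boundary (f := Y x) (f' := fun t => G t (Y x t))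
      (fun s hs => (hY x s hs).continuousWithinAt)
      (fun s hs => hasDerivWithinAt_Ici_of_Icc hs (hY x s (Ico_subset_Icc_self hs)))
      ?_ hUd ?_ ht
    · simp only [hY0, hU, sub_self, mul_zero, Real.exp_zero, mul_one]
      linarith [hx.2]
    · intro s hs hYs
      have hs' := Ico_subset_Icc_self hs
      have hUs := hU1 s hs'
      simp only [hG]
      rw [hYs, hcl_eq _ (by linarith) (hUT s hs'), poly_eq hn]
      have h0 := (abs_le.1 (hb.bound 0 s)).1
      have h1 := (abs_le.1 (hb.bound 1 s)).1
      have h2 := nonlinearCoeff_nonneg (n := n) (fun k hk => hb.nonneg k hk s)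
        (by linarith : 0 ≤ U s)
      nlinarith [mul_nonneg h2 (by linarith : 0 ≤ U s)]
  have hfR : ∀ t ∈ Icc t₀ T, f t ≤ U t := fun t ht => by
    refine image_le_of_deriv_right_lt_deriv_boundary (f := f) (f' := f')
      (fun s hs => (hf s hs).1.continuousWithinAt)
      (fun s hs => hasDerivWithinAt_Ici_of_Icc hs (hf s (Ico_subset_Icc_self hs)).1)
      ?_ hUd ?_ ht
    · rw [hf0]; linarith [hU1 t₀ (left_mem_Icc.2 hT)]
    · intro s hs hfs
      have hs' := Ico_subset_Icc_self hs
      have hUs := hU1 s hs'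
      refine (hf s hs').2.2.trans_lt ?_
      rw [hfs, poly_eq hn]
      have h0 := (abs_le.1 (hb.bound 0 s)).1
      have h1 := (abs_le.1 (hb.bound 1 s)).1
      have h2 := nonlinearCoeff_nonneg (n := n) (fun k hk => hb.nonneg k hk s)
        (by linarith : 0 ≤ U s)
      nlinarith [mul_nonneg h2 (by linarith : 0 ≤ U s)]
  have hlow : ∀ x ∈ Icc 0 M, ∀ t ∈ Icc t₀ T, 0 ≤ Y x t := fun x hx t ht => by
    refine (hf t ht).2.1.trans (le_of_subsolution_supersolution hGlip (fun s hs => (hf s hs).1)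
      (hY x) (fun s hs => ?_) (fun s _ => le_rfl) (by rw [hf0, hY0]; exact hx.1) ht)
    simp only [hG]
    rw [hcl_eq _ (hf s hs).2.1 ((hfR s hs).trans (hUT s hs))]
    exact (hf s hs).2.2
  refine ⟨Y, fun x hx => ⟨hY0 x, fun t ht => ?_, hlow x hx⟩, fun x _ x' _ hxx' =>
    le_of_subsolution_supersolution hGlip (hY x) (hY x') (fun _ _ => le_rfl) (fun _ _ => le_rfl)
      (by rwa [hY0, hY0]) (right_mem_Icc.2 hT)⟩
  have h := hY x t ht
  simp only [hG] at h
  rwa [hcl_eq _ (hlow x hx t ht) ((hup x hx t ht).trans (hUT t ht))] at h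

/-! ### Return estimate and closed solution. -/

/-- Some nonnegative initial value is not exceeded at time `T`. -/
lemma exists_return_le {n : ℕ} (hn : 2 ≤ n) {b : ℕ → ℝ → ℝ} {B t₀ T : ℝ}
    (hT : t₀ < T) (hb : IsAdmissible b B)
    (h : (∃ t ∈ Icc t₀ T, ∑ k ∈ Finset.Icc 2 n, b k t ≠ 0) ∨ 0 < ∫ τ in t₀..T, b 1 τ) :
    ∃ M, 0 ≤ M ∧ ∀ y, IsSolutionOn n b t₀ T y → y t₀ = M → (∀ t ∈ Icc t₀ T, 0 ≤ y t) →
      y T ≤ M := by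
  have hB : 0 ≤ B := (abs_nonneg _).trans (hb.bound 0 0)
  set S : ℝ → ℝ := fun t => ∑ k ∈ Finset.Icc 2 n, b k t with hS
  have hSc : Continuous S := continuous_finsetSum _ fun k _ => hb.cont k
  have hS0 : ∀ t, 0 ≤ S t := fun t =>
    Finset.sum_nonneg fun k hk => hb.nonneg k (Finset.mem_Icc.1 hk).1 t
  have hJS : 0 ≤ ∫ t in t₀..T, S t := intervalIntegral.integral_nonneg hT.le fun t _ => hS0 t
  have hJ0 : 0 ≤ ∫ t in t₀..T, |b 0 t| :=
    intervalIntegral.integral_nonneg hT.le fun t _ => abs_nonneg _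
  -- Either `m * ∫ S` wins for large `m`, or `∫ b 1` is positive and `J / m` becomes smaller than
  -- it.
  obtain ⟨m, hm1, hm⟩ : ∃ m : ℝ, 1 ≤ m ∧
      0 < (∫ t in t₀..T, b 1 t) + m * (∫ t in t₀..T, S t) - (∫ t in t₀..T, |b 0 t|) / m := by
    generalize (∫ t in t₀..T, |b 0 t|) = J at hJ0 ⊢
    rcases h with ⟨t, ht, hne⟩ | h
    · have hp : 0 < ∫ t in t₀..T, S t := intervalIntegral.integral_pos hT hSc.continuousOn
        (fun t _ => hS0 t) ⟨t, ht, (hS0 t).lt_of_ne' hne⟩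
      refine ⟨max 1 ((J - (∫ t in t₀..T, b 1 t) + 1) / ∫ t in t₀..T, S t), le_max_left _ _, ?_⟩
      have h1 := (div_le_iff₀ hp).1
        (le_max_right 1 ((J - (∫ t in t₀..T, b 1 t) + 1) / ∫ t in t₀..T, S t))
      have h2 := div_le_self hJ0
        (le_max_left 1 ((J - (∫ t in t₀..T, b 1 t) + 1) / ∫ t in t₀..T, S t))
      linarith
    · refine ⟨max 1 ((J + 1) / ∫ t in t₀..T, b 1 t), le_max_left _ _, ?_⟩
      have h1 := (div_le_iff₀ h).1 (le_max_right 1 ((J + 1) / ∫ t in t₀..T, b 1 t))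
      have h0 : 1 ≤ max 1 ((J + 1) / ∫ t in t₀..T, b 1 t) := le_max_left _ _
      generalize max 1 ((J + 1) / ∫ t in t₀..T, b 1 t) = m at h0 h1 ⊢
      have h2 : J / m < ∫ t in t₀..T, b 1 t := (div_lt_iff₀ (by linarith)).2 (by linarith)
      nlinarith [mul_nonneg (by linarith : 0 ≤ m) hJS]
  have hm0 : 0 < m := by linarith
  have he : 1 ≤ Real.exp (B * (T - t₀)) := Real.one_le_exp (mul_nonneg hB (by linarith))
  have hM0 : 0 ≤ (m + 1) * Real.exp (B * (T - t₀)) - 1 := by nlinarith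
  -- As `(y + 1)' ≤ B * (y + 1)`, a solution ending above this value has stayed above `m`
  -- throughout.
  refine ⟨(m + 1) * Real.exp (B * (T - t₀)) - 1, hM0, fun y hy hy0 hpos => ?_⟩
  generalize hMe : (m + 1) * Real.exp (B * (T - t₀)) - 1 = M at *
  by_contra! hlt
  have hge : ∀ t ∈ Icc t₀ T, m ≤ y t := fun t ht => by
    have h1 := antitoneOn_mul_exp (v := fun t => y t + 1) (c := fun _ => B) continuous_const
      (fun t ht => (hy t ht).add_const 1) (fun t ht => by
        change -poly n b t (y t) ≤ _
        rw [poly_eq hn]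
        have h0 := (abs_le.1 (hb.bound 0 t)).1
        have h1 := (abs_le.1 (hb.bound 1 t)).1
        have h2 := nonlinearCoeff_nonneg (n := n) (fun k hk => hb.nonneg k hk t) (hpos t ht)
        nlinarith [mul_nonneg h2 (hpos t ht), hpos t ht]) ht (right_mem_Icc.2 hT.le) ht.2
    simp only [intervalIntegral.integral_const, smul_eq_mul] at h1
    have h2 : Real.exp (-((t - t₀) * B)) ≤ 1 :=
      Real.exp_le_one_iff.2 (neg_nonpos.2 (mul_nonneg (sub_nonneg.2 ht.1) hB))
    have h3 : m + 1 = (M + 1) * Real.exp (-((T - t₀) * B)) := by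
      rw [← hMe, sub_add_cancel, mul_assoc, ← Real.exp_add]
      rw [show B * (T - t₀) + -((T - t₀) * B) = 0 by ring, Real.exp_zero, mul_one]
    nlinarith [Real.exp_pos (-((T - t₀) * B)), hpos t ht]
  -- On `y ≥ m` the constant term is at most `|b 0| / m * y`, giving a linear inequality whose
  -- coefficient has negative integral by `hm`.
  have hc : Continuous fun t => -(b 1 t + m * S t - |b 0 t| / m) :=
    (((hb.cont 1).add (hSc.const_mul m)).sub ((hb.cont 0).abs.div_const m)).neg
  have h1 := le_mul_exp_of_deriv_le hT.le hc hy (fun t ht => by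
    change -poly n b t (y t) ≤ _
    rw [poly_eq hn]
    have h1 := mul_sum_le_nonlinearCoeff (n := n) (fun k hk => hb.nonneg k hk t) hm1 (hge t ht)
    have h2 : |b 0 t| ≤ |b 0 t| / m * y t := by
      rw [div_mul_eq_mul_div, le_div_iff₀ hm0]
      exact mul_le_mul_of_nonneg_left (hge t ht) (abs_nonneg _)
    nlinarith [neg_abs_le (b 0 t), mul_le_mul_of_nonneg_right h1 (hpos t ht)])
    (right_mem_Icc.2 hT.le)
  have h2 : ∫ t in t₀..T, -(b 1 t + m * S t - |b 0 t| / m) =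
      -((∫ t in t₀..T, b 1 t) + m * (∫ t in t₀..T, S t) - (∫ t in t₀..T, |b 0 t|) / m) := by
    rw [intervalIntegral.integral_neg, intervalIntegral.integral_sub, intervalIntegral.integral_add,
      intervalIntegral.integral_const_mul, intervalIntegral.integral_div]
    · exact (hb.cont 1).intervalIntegrable _ _
    · exact (hSc.const_mul m).intervalIntegrable _ _
    · exact ((hb.cont 1).add (hSc.const_mul m)).intervalIntegrable _ _
    · exact ((hb.cont 0).abs.div_const m).intervalIntegrable _ _
  rw [h2, hy0] at h1
  have h3 : Real.exp (-((∫ t in t₀..T, b 1 t) + m * (∫ t in t₀..T, S t) -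
      (∫ t in t₀..T, |b 0 t|) / m)) ≤ 1 := Real.exp_le_one_iff.2 (by linarith)
  nlinarith

/-- A monotone self-map of `[0, M]` has a fixed point. -/
lemma exists_fixedPoint_of_monotone {M : ℝ} (hM : 0 ≤ M) {P : ℝ → ℝ}
    (hP : ∀ x ∈ Icc 0 M, P x ∈ Icc 0 M)
    (hmono : ∀ x ∈ Icc 0 M, ∀ x' ∈ Icc 0 M, x ≤ x' → P x ≤ P x') :
    ∃ x ∈ Icc 0 M, P x = x := by
  -- Knaster–Tarski: the supremum of the points not moved down is fixed, without any continuity of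
  -- `P`.
  set A : Set ℝ := {x | x ∈ Icc 0 M ∧ x ≤ P x} with hA
  have h0 : (0 : ℝ) ∈ A := ⟨left_mem_Icc.2 hM, (hP 0 (left_mem_Icc.2 hM)).1⟩
  have hbdd : BddAbove A := ⟨M, fun x hx => hx.1.2⟩
  have hs : sSup A ∈ Icc 0 M := ⟨le_csSup hbdd h0, csSup_le ⟨0, h0⟩ fun x hx => hx.1.2⟩
  have h1 : sSup A ≤ P (sSup A) := csSup_le ⟨0, h0⟩ fun x hx =>
    hx.2.trans (hmono x hx.1 _ hs (le_csSup hbdd hx))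
  exact ⟨sSup A, hs, le_antisymm (le_csSup hbdd ⟨hP _ hs, hmono _ hs _ (hP _ hs) h1⟩) h1⟩

lemma exists_nonneg_closedSolution {n : ℕ} (hn : 2 ≤ n) {b : ℕ → ℝ → ℝ} {B t₀ T γ : ℝ}
    (hT : t₀ < T) (hb : IsAdmissible b B) (hγ : 0 ≤ γ)
    (hE : ∀ t ∈ Icc t₀ T, WeightedCondition n b t₀ γ t)
    (h : (∃ t ∈ Icc t₀ T, ∑ k ∈ Finset.Icc 2 n, b k t ≠ 0) ∨ 0 < ∫ τ in t₀..T, b 1 τ) :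
    ∃ y, IsClosedSolutionOn n b t₀ T y ∧ ∀ t ∈ Icc t₀ T, 0 ≤ y t := by
  obtain ⟨f, f', hf0, hf⟩ := exists_nonneg_subsolution hn hT.le hb hγ hE
  obtain ⟨M, hM, hret⟩ := exists_return_le hn hT hb h
  obtain ⟨Y, hY, hmono⟩ := exists_nonneg_flow hn hT.le hb hM hf0 hf
  have hMM := right_mem_Icc.2 hM
  obtain ⟨x, hx, hfix⟩ := exists_fixedPoint_of_monotone (P := fun x => Y x T) hM
    (fun x hx => ⟨(hY x hx).2.2 T (right_mem_Icc.2 hT.le), (hmono x hx M hMM hx.2).trans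
      (hret _ (hY M hMM).2.1 (hY M hMM).1 (hY M hMM).2.2)⟩) hmono
  exact ⟨Y x, ⟨(hY x hx).2.1, (hY x hx).1.trans hfix.symm⟩, (hY x hx).2.2⟩

/-! ### Isolation. -/

/-- Solutions starting close to a nonnegative solution stay close to it. -/
lemma abs_sub_le_of_close {n : ℕ} {b : ℕ → ℝ → ℝ} {B t₀ T R δ : ℝ}
    (hb : IsAdmissible b B) {y z : ℝ → ℝ} (hy : IsSolutionOn n b t₀ T y)
    (hz : IsSolutionOn n b t₀ T z) (hyR : ∀ t ∈ Icc t₀ T, |y t| + δ ≤ R) (hδ : 0 < δ)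
    (h0 : |z t₀ - y t₀| ≤ δ * Real.exp (-((diffBound n B R + 1) * (T - t₀)))) :
    ∀ t ∈ Icc t₀ T, |z t - y t| ≤ δ := by
  intro t ht
  have hR : 0 ≤ R := by linarith [hyR t ht, abs_nonneg (y t)]
  have hD : 0 ≤ diffBound n B R := diffBound_nonneg n ((abs_nonneg _).trans (hb.bound 0 0)) hR
  set D := diffBound n B R with hDdef
  set W : ℝ → ℝ := fun s => δ * Real.exp (-((D + 1) * (T - t₀))) * Real.exp ((D + 1) * (s - t₀))
    with hW
  have hWd : ∀ s, HasDerivAt W ((D + 1) * W s) s := fun s => by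
    refine ((((hasDerivAt_id s).sub_const t₀).const_mul (D + 1)).exp.const_mul
      (δ * Real.exp (-((D + 1) * (T - t₀))))).congr_deriv ?_
    simp only [hW, id]; ring
  have hWδ : ∀ s ∈ Icc t₀ T, W s ≤ δ := fun s hs => by
    simp only [hW]
    rw [mul_assoc, ← Real.exp_add]
    refine mul_le_of_le_one_right hδ.le (Real.exp_le_one_iff.2 ?_)
    nlinarith [hs.2]
  refine le_trans ?_ (hWδ t ht)
  refine image_norm_le_of_norm_deriv_right_lt_deriv_boundary (f := fun s => z s - y s)
    (f' := fun s => -poly n b s (z s) - -poly n b s (y s))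
    (fun s hs => ((hz s hs).sub (hy s hs)).continuousWithinAt)
    (fun s hs => hasDerivWithinAt_Ici_of_Icc hs
      ((hz s (Ico_subset_Icc_self hs)).sub (hy s (Ico_subset_Icc_self hs))))
    (B := W) ?_ hWd ?_ ht
  · simpa [hW, Real.norm_eq_abs] using h0
  · intro s hs hsW
    have hs' := Ico_subset_Icc_self hs
    have hpos : 0 < W s := by simp only [hW]; positivity
    have hys := hyR s hs'
    have hzR : |z s| ≤ R := by
      have := abs_add_le (z s - y s) (y s)
      rw [sub_add_cancel] at this
      rw [Real.norm_eq_abs] at hsW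
      linarith [hWδ s hs']
    have h1 : -poly n b s (z s) - -poly n b s (y s) =
        -(dividedDiff n b s (z s) (y s) * (z s - y s)) := by rw [← poly_sub_poly]; ring
    rw [h1, norm_neg, norm_mul, hsW, Real.norm_eq_abs]
    have h2 := abs_dividedDiff_le (n := n) (fun k _ => hb.bound k s) hzR
      (by linarith : |y s| ≤ R)
    exact mul_lt_mul_of_pos_right (by linarith) hpos

lemma isIsolated_of_nonneg {n : ℕ} (hn : 2 ≤ n) {b : ℕ → ℝ → ℝ} {B t₀ T : ℝ}
    (hT : t₀ < T) (hb : IsAdmissible b B) (h1 : 0 < ∫ τ in t₀..T, b 1 τ) {y : ℝ → ℝ}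
    (hy : IsClosedSolutionOn n b t₀ T y) (hpos : ∀ t ∈ Icc t₀ T, 0 ≤ y t) :
    IsIsolatedClosedSolutionOn n b t₀ T y := by
  have hyc : ContinuousOn y (Icc t₀ T) := fun t ht => (hy.1 t ht).continuousWithinAt
  obtain ⟨K, hK⟩ := isCompact_Icc.exists_bound_of_continuousOn hyc
  have hK0 : 0 ≤ K := (norm_nonneg _).trans (hK t₀ (left_mem_Icc.2 hT.le))
  set D := diffBound n B (K + 1) with hDdef
  have hD : 0 ≤ D :=
    diffBound_nonneg n ((abs_nonneg _).trans (hb.bound 0 0)) (by linarith)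
  -- `δ ≤ 1` keeps nearby solutions within `K + 1`; dividing by `D + 1` avoids a zero denominator
  -- and makes the last bound strict.
  obtain ⟨δ, hδ, hδ1, hδJ⟩ : ∃ δ : ℝ, 0 < δ ∧ δ ≤ 1 ∧
      δ * D * (T - t₀) < ∫ τ in t₀..T, b 1 τ := by
    have hp : 0 < (D + 1) * (T - t₀) := mul_pos (by linarith) (by linarith)
    refine ⟨min 1 ((∫ τ in t₀..T, b 1 τ) / ((D + 1) * (T - t₀))),
      lt_min one_pos (div_pos h1 hp), min_le_left _ _, ?_⟩
    have h2 := (le_div_iff₀ hp).1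
      (min_le_right 1 ((∫ τ in t₀..T, b 1 τ) / ((D + 1) * (T - t₀))))
    have h3 : 0 < min 1 ((∫ τ in t₀..T, b 1 τ) / ((D + 1) * (T - t₀))) :=
      lt_min one_pos (div_pos h1 hp)
    nlinarith [mul_pos h3 (sub_pos.2 hT)]
  refine ⟨hy, δ * Real.exp (-((D + 1) * (T - t₀))), by positivity, fun z hz hzy t ht => ?_⟩
  have hclose := abs_sub_le_of_close (R := K + 1) hb hy.1 hz.1
    (fun t ht => add_le_add (by simpa using hK t ht) hδ1) hδ hzy.le
  have hc : Continuous fun t => -(2 * (b 1 t - δ * D)) :=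
    (((hb.cont 1).sub continuous_const).const_mul 2).neg
  -- Squaring the difference removes the need to know its sign.
  have hgron := fun t ht => le_mul_exp_of_deriv_le (t := t) (v := fun t => (z t - y t) ^ 2) hT.le hc
    (fun t ht => ((hz.1 t ht).sub (hy.1 t ht)).pow 2) (fun t ht => by
      change (2 : ℕ) * (z t - y t) ^ (2 - 1) * (-poly n b t (z t) - -poly n b t (y t)) ≤ _
      have h2 : -poly n b t (z t) - -poly n b t (y t) =
        -(dividedDiff n b t (z t) (y t) * (z t - y t)) := by rw [← poly_sub_poly]; ring
      have hyK : y t ≤ K := (le_abs_self _).trans (by simpa using hK t ht)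
      have hd := abs_le.1 (hclose t ht)
      have hyp := hpos t ht
      have h3 := le_dividedDiff hn (fun k _ => hb.bound k t) (fun k hk => hb.nonneg k hk t)
        (by linarith : 1 ≤ K + 1) hδ.le (abs_le.2 ⟨by linarith, by linarith⟩ : |z t| ≤ K + 1) hyp
        (by linarith) (by linarith)
      rw [h2]
      push_cast
      nlinarith [mul_le_mul_of_nonneg_right h3 (sq_nonneg (z t - y t))]) ht
  have hint : ∫ t in t₀..T, -(2 * (b 1 t - δ * D)) =
      -(2 * ((∫ t in t₀..T, b 1 t) - δ * D * (T - t₀))) := by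
    rw [intervalIntegral.integral_neg, intervalIntegral.integral_const_mul,
      intervalIntegral.integral_sub ((hb.cont 1).intervalIntegrable _ _)
        (continuous_const.intervalIntegrable _ _), intervalIntegral.integral_const, smul_eq_mul]
    ring
  -- Closedness makes the squared difference equal at both ends, while the Gronwall factor is less
  -- than `1`.
  have hzero : (z t₀ - y t₀) ^ 2 = 0 := by
    have h2 := hgron T (right_mem_Icc.2 hT.le)
    rw [hint, ← hy.2, ← hz.2] at h2
    have h3 : Real.exp (-(2 * ((∫ t in t₀..T, b 1 t) - δ * D * (T - t₀)))) < 1 :=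
      by
      rw [← Real.exp_zero]
      exact Real.exp_lt_exp.2 (by linarith)
    nlinarith [sq_nonneg (z t₀ - y t₀)]
  have h2 := hgron t ht
  rw [hzero, zero_mul] at h2
  exact sub_eq_zero.1 (pow_eq_zero_iff two_ne_zero |>.1 (le_antisymm h2 (sq_nonneg _)))

/-! ### Reduction to bounded continuous coefficients on the whole line. -/

/-- The coefficients `a k`, `k ≤ n`, frozen outside of `[t₀, T]`. -/
noncomputable def frozenCoeff (n : ℕ) (a : ℕ → ℝ → ℝ) {t₀ T : ℝ} (hT : t₀ ≤ T) (k : ℕ) (t : ℝ) :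
    ℝ :=
  if k ≤ n then a k (projIcc t₀ T hT t) else 0

lemma frozenCoeff_of_mem {n : ℕ} (a : ℕ → ℝ → ℝ) {t₀ T : ℝ} (hT : t₀ ≤ T) {k : ℕ} (hk : k ≤ n)
    {t : ℝ} (ht : t ∈ Icc t₀ T) : frozenCoeff n a hT k t = a k t := by
  rw [frozenCoeff, if_pos hk, projIcc_of_mem hT ht]

lemma exists_isAdmissible_frozenCoeff {n : ℕ} {a : ℕ → ℝ → ℝ} {t₀ T : ℝ} (hT : t₀ ≤ T)
    (ha : ∀ k ≤ n, ContinuousOn (a k) (Ici t₀))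
    (hC : ∀ k, 2 ≤ k → k ≤ n → ∀ t, t₀ ≤ t → 0 ≤ a k t) :
    ∃ B, IsAdmissible (frozenCoeff n a hT) B := by
  have hcont : ∀ k ≤ n, Continuous fun x : Icc t₀ T => a k x := fun k hk =>
    continuousOn_iff_continuous_domRestrict.1 ((ha k hk).mono Icc_subset_Ici_self)
  obtain ⟨B, hB⟩ := isCompact_univ.exists_bound_of_continuousOn
    (f := fun x : Icc t₀ T => ∑ k ∈ Finset.range (n + 1), |a k x|)
    (continuous_finsetSum _ fun k hk =>
      (hcont k (by simpa [Nat.lt_succ_iff] using hk)).abs).continuousOn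
  have hB0 : 0 ≤ B := (norm_nonneg _).trans (hB ⟨t₀, left_mem_Icc.2 hT⟩ (mem_univ _))
  refine ⟨B, fun k => ?_, fun k hk t => ?_, fun k t => ?_⟩
  · by_cases hk : k ≤ n
    · rw [show frozenCoeff n a hT k = fun t => a k (projIcc t₀ T hT t) from
        funext fun t => if_pos hk]
      exact (hcont k hk).comp continuous_projIcc
    · rw [show frozenCoeff n a hT k = fun _ => 0 from funext fun t => if_neg hk]
      exact continuous_const
  · rw [frozenCoeff]
    split_ifs with h
    · exact hC k hk h _ (projIcc t₀ T hT t).2.1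
    · exact le_rfl
  · rw [frozenCoeff]
    split_ifs with h
    · refine le_trans ?_ ((le_abs_self _).trans (hB (projIcc t₀ T hT t) (mem_univ _)))
      exact Finset.single_le_sum (f := fun k => |a k (projIcc t₀ T hT t)|)
        (fun _ _ => abs_nonneg _) (Finset.mem_range.2 (Nat.lt_succ_of_le h))
    · simpa using hB0

section Congr

variable {n : ℕ} {a b : ℕ → ℝ → ℝ} {t₀ T : ℝ}

lemma isSolutionOn_congr (h : ∀ k ≤ n, ∀ t ∈ Icc t₀ T, b k t = a k t) (y : ℝ → ℝ) :
    IsSolutionOn n b t₀ T y ↔ IsSolutionOn n a t₀ T y := by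
  refine forall₂_congr fun t ht => ?_
  rw [Finset.sum_congr rfl fun k hk =>
    by rw [h k (by simpa [Nat.lt_succ_iff] using hk) t ht]]

lemma isClosedSolutionOn_congr (h : ∀ k ≤ n, ∀ t ∈ Icc t₀ T, b k t = a k t) (y : ℝ → ℝ) :
    IsClosedSolutionOn n b t₀ T y ↔ IsClosedSolutionOn n a t₀ T y :=
  and_congr_left' (isSolutionOn_congr h y)

lemma integral_congr_of_mem {f g : ℝ → ℝ} {u v : ℝ} (hu : u ∈ Icc t₀ T) (hv : v ∈ Icc t₀ T)
    (h : ∀ t ∈ Icc t₀ T, f t = g t) : ∫ t in u..v, f t = ∫ t in u..v, g t :=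
  intervalIntegral.integral_congr fun t ht => h t (uIcc_subset_Icc hu hv ht)

lemma I_congr (hn : 1 ≤ n) (h : ∀ k ≤ n, ∀ t ∈ Icc t₀ T, b k t = a k t) (γ : ℝ) {t : ℝ}
    (ht : t ∈ Icc t₀ T) : I b t₀ γ t = I a t₀ γ t := by
  have h0 : t₀ ∈ Icc t₀ T := left_mem_Icc.2 (ht.1.trans ht.2)
  rw [I, I, integral_congr_of_mem h0 ht (h 1 hn)]
  congr 1
  refine integral_congr_of_mem h0 ht fun τ hτ => ?_
  rw [integral_congr_of_mem hτ ht (h 1 hn), h 0 (Nat.zero_le _) τ hτ]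

lemma weightedCondition_congr (hn : 1 ≤ n) (h : ∀ k ≤ n, ∀ t ∈ Icc t₀ T, b k t = a k t) (γ : ℝ)
    {t : ℝ} (ht : t ∈ Icc t₀ T) : WeightedCondition n b t₀ γ t ↔ WeightedCondition n a t₀ γ t := by
  have h0 : t₀ ∈ Icc t₀ T := left_mem_Icc.2 (ht.1.trans ht.2)
  rw [WeightedCondition, WeightedCondition]
  have : ∀ τ ∈ Icc t₀ T,
      Real.exp (∫ s in t₀..τ,
        ((∑ k ∈ Finset.Icc 2 n, b k s * I b t₀ γ s ^ (k - 1)) + b 1 s)) * b 0 τ =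
      Real.exp (∫ s in t₀..τ,
        ((∑ k ∈ Finset.Icc 2 n, a k s * I a t₀ γ s ^ (k - 1)) + a 1 s)) * a 0 τ := by
    intro τ hτ
    rw [h 0 (Nat.zero_le _) τ hτ]
    congr 2
    refine integral_congr_of_mem h0 hτ fun s hs => ?_
    rw [h 1 hn s hs, I_congr hn h γ hs]
    congr 1
    exact Finset.sum_congr rfl fun k hk => by rw [h k (Finset.mem_Icc.1 hk).2 s hs]
  rw [integral_congr_of_mem h0 ht this]

end Congr

end PolyODE

theorem theorem5p2 (n : ℕ) (hn : 2 ≤ n) (a : ℕ → ℝ → ℝ) (t₀ T : ℝ) (hT : t₀ < T)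
    (ha : ∀ k ≤ n, ContinuousOn (a k) (Set.Ici t₀))
    -- condition (C)
    (hC : ∀ k, 2 ≤ k → k ≤ n → ∀ t, t₀ ≤ t → 0 ≤ a k t)
    -- condition (D), for a usable sequence of `[t₀, +∞)`
    (N : ℕ∞) (s : ℕ → EReal) (hs : PolyODE.IsUsableSequence t₀ ⊤ N s)
    (hD : ∀ l : ℕ, 1 ≤ l → ((l + 1 : ℕ) : ℕ∞) < N →
      ∀ t : ℝ, s l ≤ (t : EReal) → (t : EReal) < s (l + 1) →
        PolyODE.RiccatiCondition a (s l).toReal t)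
    -- condition (E)
    (γ : ℝ) (hγ : 0 ≤ γ)
    (hE : ∀ t, t₀ ≤ t → PolyODE.WeightedCondition n a t₀ γ t)
    -- the additional assumption
    (h : (∃ t ∈ Set.Icc t₀ T, ∑ k ∈ Finset.Icc 2 n, a k t ≠ 0) ∨
      0 < ∫ τ in t₀..T, a 1 τ) :
    (∃ y : ℝ → ℝ, PolyODE.IsClosedSolutionOn n a t₀ T y ∧ ∀ t ∈ Set.Icc t₀ T, 0 ≤ y t) ∧
    (0 < ∫ τ in t₀..T, a 1 τ →
      ∀ y : ℝ → ℝ, PolyODE.IsClosedSolutionOn n a t₀ T y →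
        (∀ t ∈ Set.Icc t₀ T, 0 ≤ y t) → PolyODE.IsIsolatedClosedSolutionOn n a t₀ T y) := by

  have hb := fun k (hk : k ≤ n) t (ht : t ∈ Set.Icc t₀ T) =>
    PolyODE.frozenCoeff_of_mem a hT.le hk ht
  obtain ⟨B, hB⟩ := PolyODE.exists_isAdmissible_frozenCoeff hT.le ha hC
  have hint : ∫ τ in t₀..T, PolyODE.frozenCoeff n a hT.le 1 τ = ∫ τ in t₀..T, a 1 τ :=
    PolyODE.integral_congr_of_mem (Set.left_mem_Icc.2 hT.le) (Set.right_mem_Icc.2 hT.le)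
      (hb 1 (by omega))
  refine ⟨?_, fun h1 y hy hpos => ⟨hy, ?_⟩⟩
  · obtain ⟨y, hy, hpos⟩ := PolyODE.exists_nonneg_closedSolution hn hT hB hγ
      (fun t ht => (PolyODE.weightedCondition_congr (by omega) hb γ ht).2 (hE t ht.1)) (by
        rw [hint]
        refine h.imp_left ?_
        rintro ⟨t, ht, hne⟩
        refine ⟨t, ht, ?_⟩
        rwa [Finset.sum_congr rfl fun k hk => hb k (Finset.mem_Icc.1 hk).2 t ht])
    exact ⟨y, (PolyODE.isClosedSolutionOn_congr hb y).1 hy, hpos⟩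
  · obtain ⟨-, ε, hε, hiso⟩ := PolyODE.isIsolated_of_nonneg hn hT hB (by rwa [hint])
      ((PolyODE.isClosedSolutionOn_congr hb y).2 hy) hpos
    exact ⟨ε, hε, fun z hz => hiso z ((PolyODE.isClosedSolutionOn_congr hb z).2 hz)⟩
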